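/- Let $\mathbb{S}^3=\{x\in\mathbb{R}^4 : \langle x,x\rangle=1\}$ carry the Riemannian metric induced from $\mathbb{R}^4$, and let $\mathrm{Isom}(\mathbb{S}^3)$ be the group of its Riemannian isometries, i.e. of the diffeomorphisms of $\mathbb{S}^3$ whose differential preserves the metric. Let $S\subset\mathbb{S}^3$ be a regular (smooth, embedded, $2$-dimensional), connected surface, oriented by a smooth unit normal field $N$: thus $N:S\to\mathbb{R}^4$ is smooth, $|N|=1$, and $N(p)$ is tangent to $\mathbb{S}^3$ and orthogonal to $T_pS$ for every $p\in S$. For $p\in S$ let $\lambda_1(p)\le\lambda_2(p)$ be the principal curvatures of $S$ in $\mathbb{S}^3$ with respect to $N$, i.e. the smallest and the largest eigenvalue of the shape operator $v\mapsto -dN_p(v)$ on $T_pS$, and let $K=1+\lambda_1\lambda_2$ be the Gaussian curvature of $S$. Suppose that $S$ is extrinsically homogeneous, that is, for all $x,y\in S$ there is $g\in\mathrm{Isom}(\mathbb{S}^3)$ with $g(S)\subset S$ and $g(x)=y$. Then: (0) for every $p\in S$ there is an orthonormal basis $e_1,e_2$ of $T_pS$ with $-dN_p(e_i)=\lambda_i(p)\,e_i$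 for $i=1,2$ (so that the principal curvatures are well defined); (i) the Gaussian curvature $K$ is constant on $S$; (ii) the principal curvatures $\lambda_1$ and $\lambda_2$ are constant functions on $S$. -/

import Mathlib

open scoped Manifold ContDiff

noncomputable section

/-- Euclidean space `ℝ⁴`. -/
abbrev E4 : Type := EuclideanSpace ℝ (Fin 4)

instance finrankE4 : Fact (Module.finrank ℝ E4 = 3 + 1) := ⟨finrank_euclideanSpace_fin⟩

/-- The unit sphere `𝕊³ = {x ∈ ℝ⁴ | ⟪x, x⟫ = 1}`, with Mathlib's smooth structure. -/
abbrev S3 : Type := Metric.sphere (0 : E4) 1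

/-- The differential at `x` of the inclusion `𝕊³ → ℝ⁴`. -/
def sphereIncl (x : S3) : TangentSpace (𝓡 3) x →L[ℝ] E4 :=
  mvfderiv (𝓡 3) (fun y : S3 => (y : E4)) x

/-- The round Riemannian metric of `𝕊³`, induced by the Euclidean inner product of `ℝ⁴`. -/
def sphereMetric (x : S3) (v w : TangentSpace (𝓡 3) x) : ℝ :=
  inner ℝ (sphereIncl x v) (sphereIncl x w)

/-- `Isom(𝕊³)`: the diffeomorphisms of `𝕊³` whose differential preserves the Riemannian metric. -/
def IsomS3 : Set (Diffeomorph (𝓡 3) (𝓡 3) S3 S3 ∞) :=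
  {g | ∀ (x : S3) (v w : TangentSpace (𝓡 3) x),
    sphereMetric (g x) (mfderiv (𝓡 3) (𝓡 3) g x v) (mfderiv (𝓡 3) (𝓡 3) g x w)
      = sphereMetric x v w}

/-- `S ⊆ 𝕊³` is extrinsically homogeneous: the isometries `g` of `𝕊³` with `g(S) ⊆ S` act
transitively on `S`. -/
def ExtrinsicallyHomogeneous (S : Set S3) : Prop :=
  ∀ x ∈ S, ∀ y ∈ S, ∃ g ∈ IsomS3, g '' S ⊆ S ∧ g x = y

section Surface

variable {S : Set S3} [ChartedSpace (EuclideanSpace ℝ (Fin 2)) S]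

/-- The differential at `p` of an `ℝ⁴`-valued map on the surface `S`. -/
def surfDeriv (f : S → E4) (p : S) : TangentSpace (𝓡 2) p →L[ℝ] E4 :=
  mvfderiv (𝓡 2) f p

/-- The differential at `p` of the inclusion `S → ℝ⁴`; its range is the tangent plane of `S` at
`p`, seen in `ℝ⁴`. -/
def surfIncl (p : S) : TangentSpace (𝓡 2) p →L[ℝ] E4 :=
  surfDeriv (fun q : S => ((q : S3) : E4)) p

/-- `N` is a smooth field of unit vectors tangent to `𝕊³` and orthogonal to `S`, that is, an
orientation of `S ⊆ 𝕊³`. -/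
structure IsUnitNormal (N : S → E4) : Prop where
  smooth : ContMDiff (𝓡 2) 𝓘(ℝ, E4) ∞ N
  norm_eq_one : ∀ p, ‖N p‖ = 1
  tangent_sphere : ∀ p : S, inner ℝ (N p) ((p : S3) : E4) = 0
  normal : ∀ (p : S) (v : TangentSpace (𝓡 2) p), inner ℝ (N p) (surfIncl p v) = 0

/-- `μ` is an eigenvalue at `p` of the shape operator `v ↦ -dN(v)` of `S` in `𝕊³`, the operator
of the second fundamental form `(v, w) ↦ -⟪dN(v), w⟫`. -/
def IsPrincipalCurvatureAt (N : S → E4) (p : S) (μ : ℝ) : Prop :=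
  ∃ v : TangentSpace (𝓡 2) p, v ≠ 0 ∧ -surfDeriv N p v = μ • surfIncl p v

/-- `e₁, e₂` is an orthonormal basis of the tangent plane at `p` in which the shape operator is
diagonal with entries `a, b`. -/
def IsPrincipalBasis (N : S → E4) (p : S) (a b : ℝ) (e₁ e₂ : TangentSpace (𝓡 2) p) : Prop :=
  inner ℝ (surfIncl p e₁) (surfIncl p e₁) = 1 ∧
  inner ℝ (surfIncl p e₂) (surfIncl p e₂) = 1 ∧
  inner ℝ (surfIncl p e₁) (surfIncl p e₂) = 0 ∧
  -surfDeriv N p e₁ = a • surfIncl p e₁ ∧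
  -surfDeriv N p e₂ = b • surfIncl p e₂

/-- The smaller principal curvature `λ₁` of `S` with respect to `N`. -/
def principalCurvature₁ (N : S → E4) (p : S) : ℝ :=
  sInf {μ : ℝ | IsPrincipalCurvatureAt N p μ}

/-- The larger principal curvature `λ₂` of `S` with respect to `N`. -/
def principalCurvature₂ (N : S → E4) (p : S) : ℝ :=
  sSup {μ : ℝ | IsPrincipalCurvatureAt N p μ}

/-- The Gaussian curvature `K = 1 + λ₁ λ₂` of a surface of `𝕊³`. -/
def gaussianCurvature (N : S → E4) (p : S) : ℝ :=
  1 + principalCurvature₁ N p * principalCurvature₂ N p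

end Surface

end

/-! Let `g` be an isometry of the sphere mapping `S` into itself. It is the restriction of a linear
isometry `A` of `ℝ⁴` (`exists_linearIsometryEquiv_of_mem_isomS3`). Its differential carries tangent
planes of `S` onto tangent planes, so `A (N x)` is `± N (g x)`. By continuity and connectedness of
`S` the sign is the same everywhere. Differentiating this relation shows that the shape operators at
`p` and `g p` are conjugate up to that sign (`principalCurvature_isometry`). Homogeneity then leaves
two options for the pair `(λ₁, λ₂)` at any point: `(a, b)`, its value at a base point, or `(-b,
-a)`.

The product `λ₁ λ₂` is the same in both cases, but the sum changes sign. The sum is the trace of the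
shape operator, hence continuous (`continuous_principalCurvature_add`), and its square is constant.
On a connected surface the sum is therefore constant, which excludes the second option unless `a + b
= 0`, when the two options coincide.

Linearity of `g` comes from great circles: `g` preserves speeds, and a curve on the sphere is at
least as long as the angle between its endpoints, so `g` does not increase angles. Antipodes turn
this inequality into an equality. -/

/-! ### Length and angle for curves on the unit sphere -/

section SphereCurves

variable {E : Type*} [NormedAddCommGroup E] [InnerProductSpace ℝ E]

/-- In the plane of two orthogonal vectors `h`, `h'` with `‖h‖ = 1` and `‖h'‖ ≤ 1`, Bessel's
inequality bounds the coefficients of a unit vector `p`. -/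
lemma inner_sq_add_inner_sq_le_one {p h h' : E} (hp : ‖p‖ = 1) (hh : ‖h‖ = 1) (hh' : ‖h'‖ ≤ 1)
    (horth : inner ℝ h h' = 0) : inner ℝ p h ^ 2 + inner ℝ p h' ^ 2 ≤ 1 := by
  set a := inner ℝ p h
  set b := inner ℝ p h'
  have h1 : inner ℝ p (a • h + b • h') = a ^ 2 + b ^ 2 := by
    rw [inner_add_right, inner_smul_right, inner_smul_right]; ring
  have h2 : ‖a • h + b • h'‖ ^ 2 ≤ a ^ 2 + b ^ 2 := by
    rw [norm_add_sq_real, inner_smul_left, inner_smul_right, horth, norm_smul, norm_smul, hh,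
      mul_pow, mul_pow, Real.norm_eq_abs, Real.norm_eq_abs, sq_abs, sq_abs]
    have : b ^ 2 * ‖h'‖ ^ 2 ≤ b ^ 2 * 1 :=
      mul_le_mul_of_nonneg_left (by nlinarith [norm_nonneg h']) (sq_nonneg b)
    simp only [mul_zero, one_pow, mul_one]
    linarith
  have h3 := real_inner_le_norm p (a • h + b • h')
  rw [h1, hp, one_mul] at h3
  nlinarith [norm_nonneg (a • h + b • h'), sq_nonneg a, sq_nonneg b]

/-- A curve of speed at most one on the unit sphere sweeps an angle at most its duration. -/
lemma arccos_inner_le_of_norm_deriv_le {h h' : ℝ → E} (hd : ∀ t, HasDerivAt h (h' t) t)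
    (h1 : ∀ t, ‖h t‖ = 1) (h1' : ∀ t, ‖h' t‖ ≤ 1) {θ : ℝ} (hθ : 0 ≤ θ) :
    Real.arccos (inner ℝ (h 0) (h θ)) ≤ θ := by
  have horth : ∀ t, inner ℝ (h t) (h' t) = 0 := by
    intro t
    have e1 := (hd t).inner ℝ (hd t)
    have e2 : (fun t => inner ℝ (h t) (h t)) = fun _ => (1 : ℝ) := by
      funext s; rw [real_inner_self_eq_norm_sq, h1, one_pow]
    rw [e2] at e1
    have e3 := e1.unique (hasDerivAt_const t (1 : ℝ))
    rw [real_inner_comm (h t) (h' t)] at e3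
    linarith
  set u : ℝ → ℝ := fun t => inner ℝ (h 0) (h t)
  set u' : ℝ → ℝ := fun t => inner ℝ (h 0) (h' t)
  have hu : ∀ t, HasDerivAt u (u' t) t := by
    intro t
    simpa using (hasDerivAt_const t (h 0)).inner ℝ (hd t)
  have hb : ∀ t, u t ^ 2 + u' t ^ 2 ≤ 1 := fun t =>
    inner_sq_add_inner_sq_le_one (h1 0) (h1 t) (h1' t) (horth t)
  -- `arccos` is not differentiable at `±1`, and `u` equals `1` at time `0`. The factor `r < 1`
  -- keeps the argument inside `(-1, 1)`; continuity of `arccos` then lets `r` tend to `1`.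
  have key : ∀ r ∈ Set.Ioo (0 : ℝ) 1, Real.arccos (r * u θ) - Real.arccos (r * u 0) ≤ θ := by
    rintro r ⟨hr0, hr1⟩
    have hlt : ∀ t, (r * u t) ^ 2 < 1 := by
      intro t
      have : u t ^ 2 ≤ 1 := by nlinarith [hb t, sq_nonneg (u' t)]
      have : r ^ 2 < 1 := by nlinarith
      nlinarith [sq_nonneg (u t), sq_nonneg r]
    have hder : ∀ t, HasDerivAt (fun s => Real.arccos (r * u s))
        (-(1 / √(1 - (r * u t) ^ 2)) * (r * u' t)) t := by
      intro t
      have h3 := abs_lt.mp ((sq_lt_one_iff_abs_lt_one _).mp (hlt t))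
      exact HasDerivAt.comp (h₂ := Real.arccos) t (Real.hasDerivAt_arccos h3.1.ne' h3.2.ne) ((hu t).const_mul r)
    have hbound : ∀ t, ‖-(1 / √(1 - (r * u t) ^ 2)) * (r * u' t)‖ ≤ 1 := by
      intro t
      have hpos : 0 < √(1 - (r * u t) ^ 2) := Real.sqrt_pos.mpr (by linarith [hlt t])
      rw [Real.norm_eq_abs, abs_mul, abs_neg, abs_of_pos (by positivity), one_div,
        inv_mul_le_iff₀ hpos, mul_one]
      apply Real.abs_le_sqrt
      have : r ^ 2 < 1 := by nlinarith
      nlinarith [hb t, sq_nonneg r]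
    have h4 := (convex_univ (𝕜 := ℝ) (E := ℝ)).norm_image_sub_le_of_norm_hasDerivWithin_le
      (fun t _ => (hder t).hasDerivWithinAt) (fun t _ => hbound t) (Set.mem_univ 0)
      (Set.mem_univ θ)
    rw [sub_zero, one_mul, Real.norm_of_nonneg hθ] at h4
    exact (le_abs_self _).trans h4
  have hlim : Filter.Tendsto (fun r : ℝ => Real.arccos (r * u θ) - Real.arccos (r * u 0))
      (nhdsWithin 1 (Set.Ioo 0 1)) (nhds (Real.arccos (1 * u θ) - Real.arccos (1 * u 0))) := by
    apply Filter.Tendsto.mono_left _ nhdsWithin_le_nhds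
    have : Continuous (fun r : ℝ => Real.arccos (r * u θ) - Real.arccos (r * u 0)) := by
      have := Real.continuous_arccos
      fun_prop
    exact this.tendsto 1
  have hne : (nhdsWithin (1 : ℝ) (Set.Ioo 0 1)).NeBot := right_nhdsWithin_Ioo_neBot one_pos
  have hu0 : u 0 = 1 := by
    simp only [u]; rw [real_inner_self_eq_norm_sq, h1, one_pow]
  have := le_of_tendsto hlim (Filter.eventually_of_mem self_mem_nhdsWithin key)
  rwa [one_mul, one_mul, hu0, Real.arccos_one, sub_zero] at this

end SphereCurves

/-! ### Riemannian isometries of the sphere are linear -/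

section SphereIsometries

lemma norm_sphere_coe (x : S3) : ‖(x : E4)‖ = 1 := by simp

lemma mdifferentiableAt_sphere_coe (x : S3) :
    MDifferentiableAt (𝓡 3) 𝓘(ℝ, E4) (fun y : S3 => (y : E4)) x :=
  (contMDiff_coe_sphere (m := 1) x).mdifferentiableAt one_ne_zero

/-- A Riemannian isometry of `𝕊³` maps unit speed curves to unit speed curves. -/
lemma exists_hasDerivAt_isometry_comp {g : Diffeomorph (𝓡 3) (𝓡 3) S3 S3 ∞} (hg : g ∈ IsomS3)
    {c : ℝ → S3} (hc : ContMDiff 𝓘(ℝ, ℝ) (𝓡 3) 1 c) (t : ℝ) {c' : E4}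
    (hc' : HasDerivAt (fun s => (c s : E4)) c' t) :
    ∃ w : E4, HasDerivAt (fun s => (g (c s) : E4)) w t ∧ ‖w‖ = ‖c'‖ := by
  have hct : MDifferentiableAt 𝓘(ℝ, ℝ) (𝓡 3) c t := (hc t).mdifferentiableAt one_ne_zero
  have hgt : MDifferentiableAt (𝓡 3) (𝓡 3) g (c t) :=
    g.contMDiff.mdifferentiableAt (by simp)
  set v : TangentSpace (𝓡 3) (c t) := mfderiv 𝓘(ℝ, ℝ) (𝓡 3) c t (1 : ℝ) with hv
  have m1 : HasFDerivAt (fun s => (c s : E4))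
      ((sphereIncl (c t)).comp (mfderiv 𝓘(ℝ, ℝ) (𝓡 3) c t) : ℝ →L[ℝ] E4) t :=
    hasMFDerivAt_iff_hasFDerivAt.mp
      ((mdifferentiableAt_sphere_coe (c t)).hasMFDerivAt.comp t hct.hasMFDerivAt)
  have m2 : HasFDerivAt (fun s => (g (c s) : E4))
      ((sphereIncl (g (c t))).comp ((mfderiv (𝓡 3) (𝓡 3) g (c t)).comp
        (mfderiv 𝓘(ℝ, ℝ) (𝓡 3) c t)) : ℝ →L[ℝ] E4) t :=
    hasMFDerivAt_iff_hasFDerivAt.mp ((mdifferentiableAt_sphere_coe (g (c t))).hasMFDerivAt.comp t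
      (hgt.hasMFDerivAt.comp t hct.hasMFDerivAt))
  have d1 : HasDerivAt (fun s => (c s : E4)) (sphereIncl (c t) v) t := m1.hasDerivAt
  have d2 : HasDerivAt (fun s => (g (c s) : E4))
      (sphereIncl (g (c t)) (mfderiv (𝓡 3) (𝓡 3) g (c t) v)) t := m2.hasDerivAt
  have e1 : c' = sphereIncl (c t) v := hc'.unique d1
  refine ⟨sphereIncl (g (c t)) (mfderiv (𝓡 3) (𝓡 3) g (c t) v), d2, ?_⟩
  have h := hg (c t) v v
  simp only [sphereMetric, real_inner_self_eq_norm_sq] at h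
  rw [e1]
  exact (pow_left_inj₀ (norm_nonneg _) (norm_nonneg _) two_ne_zero).mp h

/-- Riemannian isometries of `𝕊³` do not increase angles. -/
lemma arccos_inner_isometry_le {g : Diffeomorph (𝓡 3) (𝓡 3) S3 S3 ∞} (hg : g ∈ IsomS3)
    (x y : S3) : Real.arccos (inner ℝ (g x : E4) (g y)) ≤ Real.arccos (inner ℝ (x : E4) y) := by
  set a := inner ℝ (x : E4) y with ha
  set θ := Real.arccos a
  have hle : a ^ 2 ≤ 1 := by
    have := abs_real_inner_le_norm (x : E4) y
    rw [norm_sphere_coe, norm_sphere_coe, one_mul] at this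
    exact (sq_le_one_iff_abs_le_one _).mpr this
  have hcos : Real.cos θ = a := by
    have := (sq_le_one_iff_abs_le_one _).mp hle
    exact Real.cos_arccos (abs_le.mp this).1 (abs_le.mp this).2
  -- `v` is the initial direction of a great circle from `x` reaching `y` at time `θ`. When `y = ±
  -- x` any unit vector orthogonal to `x` serves, since `sin θ = 0`.
  obtain ⟨v, hv1, hxv, hy⟩ : ∃ v : E4, ‖v‖ = 1 ∧ inner ℝ (x : E4) v = 0 ∧
      (y : E4) = Real.cos θ • (x : E4) + Real.sin θ • v := by
    have hn : ‖(y : E4) - a • (x : E4)‖ ^ 2 = 1 - a ^ 2 := by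
      rw [norm_sub_sq_real, inner_smul_right, real_inner_comm, ← ha, norm_smul, norm_sphere_coe,
        norm_sphere_coe, mul_pow, Real.norm_eq_abs, sq_abs]
      ring
    have hsin : Real.sin θ = ‖(y : E4) - a • (x : E4)‖ := by
      rw [Real.sin_arccos, ← hn, Real.sqrt_sq (norm_nonneg _)]
    by_cases h0 : (y : E4) - a • (x : E4) = 0
    · obtain ⟨v, hv⟩ : ∃ v : E4, v ∈ (ℝ ∙ (x : E4))ᗮ ∧ v ≠ 0 := by
        have : (ℝ ∙ (x : E4))ᗮ ≠ ⊥ := by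
          intro h
          have h2 := Submodule.finrank_orthogonal_span_singleton (𝕜 := ℝ) (n := 3)
            (v := (x : E4)) (by rw [← norm_ne_zero_iff, norm_sphere_coe]; exact one_ne_zero)
          rw [h, finrank_bot] at h2
          omega
        exact Submodule.exists_mem_ne_zero_of_ne_bot this
      refine ⟨‖v‖⁻¹ • v, ?_, ?_, ?_⟩
      · rw [norm_smul, norm_inv, norm_norm, inv_mul_cancel₀ (norm_ne_zero_iff.mpr hv.2)]
      · rw [inner_smul_right, Submodule.mem_orthogonal_singleton_iff_inner_right.mp hv.1, mul_zero]
      · rw [hsin, h0, norm_zero, zero_smul, add_zero, hcos]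
        exact sub_eq_zero.mp h0
    · have hn0 : ‖(y : E4) - a • (x : E4)‖ ≠ 0 := norm_ne_zero_iff.mpr h0
      refine ⟨‖(y : E4) - a • (x : E4)‖⁻¹ • ((y : E4) - a • (x : E4)), ?_, ?_, ?_⟩
      · rw [norm_smul, norm_inv, norm_norm, inv_mul_cancel₀ hn0]
      · rw [inner_smul_right, inner_sub_right, inner_smul_right, real_inner_self_eq_norm_sq,
          norm_sphere_coe, ← ha]
        ring
      · rw [hsin, smul_inv_smul₀ hn0, hcos, add_sub_cancel]
  set γ : ℝ → E4 := fun t => Real.cos t • (x : E4) + Real.sin t • v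
  set γ' : ℝ → E4 := fun t => (-Real.sin t) • (x : E4) + Real.cos t • v
  have hnorm : ∀ p q : ℝ, ‖p • (x : E4) + q • v‖ ^ 2 = p ^ 2 + q ^ 2 := by
    intro p q
    rw [norm_add_sq_real, inner_smul_left, inner_smul_right, hxv, norm_smul, norm_smul,
      norm_sphere_coe, hv1, mul_pow, mul_pow, Real.norm_eq_abs, Real.norm_eq_abs, sq_abs, sq_abs]
    simp
  have hγ1 : ∀ t, ‖γ t‖ = 1 := fun t => by
    have := hnorm (Real.cos t) (Real.sin t)
    rw [Real.cos_sq_add_sin_sq] at this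
    exact (pow_eq_one_iff_of_nonneg (norm_nonneg _) two_ne_zero).mp this
  have hγ1' : ∀ t, ‖γ' t‖ = 1 := fun t => by
    have := hnorm (-Real.sin t) (Real.cos t)
    rw [neg_sq, Real.sin_sq_add_cos_sq] at this
    exact (pow_eq_one_iff_of_nonneg (norm_nonneg _) two_ne_zero).mp this
  have hγd : ∀ t, HasDerivAt γ (γ' t) t := fun t =>
    ((Real.hasDerivAt_cos t).smul_const (x : E4)).add ((Real.hasDerivAt_sin t).smul_const v)
  have hγs : ContMDiff 𝓘(ℝ, ℝ) 𝓘(ℝ, E4) 1 γ := by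
    have : ContDiff ℝ 1 γ :=
      (Real.contDiff_cos.smul contDiff_const).add (Real.contDiff_sin.smul contDiff_const)
    exact this.contMDiff
  have hmem : ∀ t, γ t ∈ Metric.sphere (0 : E4) 1 := fun t => by simpa using hγ1 t
  set c : ℝ → S3 := Set.codRestrict γ _ hmem
  have hc : ContMDiff 𝓘(ℝ, ℝ) (𝓡 3) 1 c := hγs.codRestrict_sphere hmem
  choose w hw hwn using fun t => exists_hasDerivAt_isometry_comp hg hc t (hγd t)
  have h := arccos_inner_le_of_norm_deriv_le hw (fun t => norm_sphere_coe _)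
    (fun t => by rw [hwn, hγ1']) (Real.arccos_nonneg a)
  have c0 : c 0 = x := Subtype.ext (by simp [c, γ])
  have cθ : c θ = y := Subtype.ext hy.symm
  rwa [c0, cθ] at h

/-- Riemannian isometries of `𝕊³` preserve inner products. -/
lemma inner_isometry_eq {g : Diffeomorph (𝓡 3) (𝓡 3) S3 S3 ∞} (hg : g ∈ IsomS3) (x y : S3) :
    inner ℝ (g x : E4) (g y) = inner ℝ (x : E4) y := by
  have hb : ∀ a b : S3, -1 ≤ inner ℝ (a : E4) b ∧ inner ℝ (a : E4) b ≤ 1 := fun a b => by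
    have := abs_real_inner_le_norm (a : E4) b
    rw [norm_sphere_coe, norm_sphere_coe, one_mul] at this
    exact abs_le.mp this
  have hle : ∀ a b : S3, inner ℝ (a : E4) b ≤ inner ℝ (g a : E4) (g b) := fun a b =>
    (Real.strictAntiOn_arccos.le_iff_ge (hb _ _) (hb _ _)).mp (arccos_inner_isometry_le hg a b)
  -- If `g z = -g a`, the inequality `hle` forces the inner product of `a` and `z` down to its
  -- minimum `-1`, so `z = -a`.
  have hneg : ∀ a : S3, g (-a) = -g a := by
    intro a
    obtain ⟨z, hz⟩ : ∃ z, g z = -g a := g.surjective (-g a)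
    have h1 := hle a z
    rw [hz, coe_neg_sphere, inner_neg_right, real_inner_self_eq_norm_sq, norm_sphere_coe] at h1
    have h2 : inner ℝ ((-a : S3) : E4) z = 1 := by
      rw [coe_neg_sphere, inner_neg_left]
      linarith [(hb a z).1]
    rw [← hz, ← (sphere_ext_iff (-a) z).mpr h2]
  refine le_antisymm ?_ (hle x y)
  -- Replacing `y` by its antipode changes the sign of both sides and so reverses the inequality.
  have h := hle x (-y)
  rw [hneg, coe_neg_sphere, coe_neg_sphere, inner_neg_right, inner_neg_right] at h
  linarith

/-- Riemannian isometries of `𝕊³` are restrictions of linear isometries of `ℝ⁴`. -/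
lemma exists_linearIsometryEquiv_of_mem_isomS3 {g : Diffeomorph (𝓡 3) (𝓡 3) S3 S3 ∞}
    (hg : g ∈ IsomS3) : ∃ A : E4 ≃ₗᵢ[ℝ] E4, ∀ x : S3, (g x : E4) = A x := by
  set b := EuclideanSpace.basisFun (Fin 4) ℝ
  have hbm : ∀ i, b i ∈ Metric.sphere (0 : E4) 1 := fun i => by simp [b]
  set s : Fin 4 → S3 := fun i => ⟨b i, hbm i⟩
  have hon : Orthonormal ℝ (fun i => (g (s i) : E4)) := by
    rw [orthonormal_iff_ite]
    intro i j
    rw [inner_isometry_eq hg]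
    exact orthonormal_iff_ite.mp b.orthonormal i j
  set b' : OrthonormalBasis (Fin 4) ℝ E4 := OrthonormalBasis.mk hon (by
    have := hon.linearIndependent.span_eq_top_of_card_eq_finrank (by simp)
    exact this.ge)
  refine ⟨b.equiv b' (Equiv.refl _), fun x => ?_⟩
  rw [← b'.sum_repr (g x), ← b.sum_repr (x : E4), map_sum]
  refine Finset.sum_congr rfl fun i _ => ?_
  rw [map_smul, OrthonormalBasis.equiv_apply_basis, b'.repr_apply_apply, b.repr_apply_apply]
  simp only [b', OrthonormalBasis.coe_mk, inner_isometry_eq hg]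
  rfl

end SphereIsometries

/-! ### Linear algebra of the shape operator on a plane -/

section PencilOfForms

variable {V E : Type*} [AddCommGroup V] [Module ℝ V] [NormedAddCommGroup E]
  [InnerProductSpace ℝ E]

/-- Two symmetric forms `⟪P ·, P ·⟫`, `-⟪Q ·, P ·⟫` on a plane are simultaneously diagonalizable. -/
lemma exists_orthonormal_eigenvectors (hV : Module.finrank ℝ V = 2) (P Q : V →ₗ[ℝ] E)
    (hP : Function.Injective P) (hsymm : ∀ v w, inner ℝ (Q v) (P w) = inner ℝ (P v) (Q w))
    (hran : ∀ v, Q v ∈ LinearMap.range P) :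
    ∃ (a b : ℝ) (e₁ e₂ : V), a ≤ b ∧ inner ℝ (P e₁) (P e₁) = (1 : ℝ) ∧
      inner ℝ (P e₂) (P e₂) = (1 : ℝ) ∧ inner ℝ (P e₁) (P e₂) = (0 : ℝ) ∧
      -Q e₁ = a • P e₁ ∧ -Q e₂ = b • P e₂ := by
  have : FiniteDimensional ℝ V := Module.finite_of_finrank_eq_succ hV
  let P' : V ≃ₗ[ℝ] LinearMap.range P := LinearEquiv.ofInjective P hP
  have hP' : ∀ x, P (P'.symm x) = x := fun x =>
    congrArg Subtype.val (P'.apply_symm_apply x)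
  -- Transporting `-Q` to the image of `P` gives a self-adjoint endomorphism of a Euclidean plane,
  -- to which the spectral theorem applies.
  let T : LinearMap.range P →ₗ[ℝ] LinearMap.range P :=
    (-(Q.codRestrict _ hran)).comp P'.symm.toLinearMap
  have hTval : ∀ x, (T x : E) = -Q (P'.symm x) := fun x => rfl
  have hT : T.IsSymmetric := by
    intro x y
    rw [Submodule.coe_inner, Submodule.coe_inner, hTval, hTval, inner_neg_left, inner_neg_right]
    have := hsymm (P'.symm x) (P'.symm y)
    rw [hP', hP'] at this
    rw [this]
  have hfin : Module.finrank ℝ (LinearMap.range P) = 2 := by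
    rw [← P'.finrank_eq, hV]
  let b := hT.eigenvectorBasis hfin
  let l := hT.eigenvalues hfin
  have heig : ∀ i, -Q (P'.symm (b i)) = l i • P (P'.symm (b i)) := fun i => by
    rw [hP', ← hTval, hT.apply_eigenvectorBasis hfin i]
    rfl
  have hon := orthonormal_iff_ite.mp b.orthonormal
  have hinn : ∀ i j, inner ℝ (P (P'.symm (b i))) (P (P'.symm (b j))) =
      if i = j then (1 : ℝ) else 0 := fun i j => by
    rw [hP', hP', ← Submodule.coe_inner]; exact hon i j
  rcases le_total (l 0) (l 1) with h | h
  · exact ⟨l 0, l 1, _, _, h, by simpa using hinn 0 0, by simpa using hinn 1 1,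
      by simpa using hinn 0 1, heig 0, heig 1⟩
  · exact ⟨l 1, l 0, _, _, h, by simpa using hinn 1 1, by simpa using hinn 0 0,
      by simpa using hinn 1 0, heig 1, heig 0⟩

/-- Vectors with orthonormal images span a plane. -/
lemma exists_eq_smul_add_smul (hV : Module.finrank ℝ V = 2) (P : V →ₗ[ℝ] E) {e₁ e₂ : V}
    (h₁ : inner ℝ (P e₁) (P e₁) = (1 : ℝ)) (h₂ : inner ℝ (P e₂) (P e₂) = (1 : ℝ))
    (h₁₂ : inner ℝ (P e₁) (P e₂) = (0 : ℝ)) (v : V) : ∃ x y : ℝ, v = x • e₁ + y • e₂ := by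
  have : FiniteDimensional ℝ V := Module.finite_of_finrank_eq_succ hV
  have hli : LinearIndependent ℝ ![e₁, e₂] := by
    rw [LinearIndependent.pair_iff]
    intro s t hst
    have h := congrArg P hst
    rw [map_add, map_smul, map_smul, map_zero] at h
    have i1 := congrArg (fun z => inner ℝ (P e₁) z) h
    have i2 := congrArg (fun z => inner ℝ (P e₂) z) h
    simp only [inner_add_right, inner_smul_right, inner_zero_right, h₁, h₂, h₁₂,
      real_inner_comm (P e₁) (P e₂)] at i1 i2
    constructor <;> linarith
  have hspan := hli.span_eq_top_of_card_eq_finrank (by simp [hV])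
  have hv : v ∈ Submodule.span ℝ (Set.range ![e₁, e₂]) := hspan ▸ Submodule.mem_top
  rw [Matrix.range_cons, Matrix.range_cons, Matrix.range_empty, Set.union_empty,
    Set.singleton_union, Submodule.mem_span_pair] at hv
  obtain ⟨x, y, h⟩ := hv
  exact ⟨x, y, h.symm⟩

/-- The eigenvalues of a diagonalized pencil are its diagonal entries. -/
lemma setOf_eigenvalues_eq_pair (hV : Module.finrank ℝ V = 2) (P Q : V →ₗ[ℝ] E)
    {a b : ℝ} {e₁ e₂ : V}
    (h₁ : inner ℝ (P e₁) (P e₁) = (1 : ℝ)) (h₂ : inner ℝ (P e₂) (P e₂) = (1 : ℝ))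
    (h₁₂ : inner ℝ (P e₁) (P e₂) = (0 : ℝ)) (ha : -Q e₁ = a • P e₁) (hb : -Q e₂ = b • P e₂) :
    {μ : ℝ | ∃ v : V, v ≠ 0 ∧ -Q v = μ • P v} = {a, b} := by
  ext μ
  simp only [Set.mem_ofPred_eq, Set.mem_insert_iff, Set.mem_singleton_iff]
  constructor
  · rintro ⟨v, hv, h⟩
    obtain ⟨x, y, rfl⟩ := exists_eq_smul_add_smul hV P h₁ h₂ h₁₂ v
    have e : -Q (x • e₁ + y • e₂) = (x * a) • P e₁ + (y * b) • P e₂ := by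
      rw [map_add, map_smul, map_smul, neg_add, ← smul_neg, ← smul_neg, ha, hb, smul_smul,
        smul_smul]
    rw [e, map_add, map_smul, map_smul] at h
    have i1 := congrArg (fun z => inner ℝ (P e₁) z) h
    have i2 := congrArg (fun z => inner ℝ (P e₂) z) h
    simp only [smul_add, inner_add_right, inner_smul_right, h₁, h₂, h₁₂,
      real_inner_comm (P e₁) (P e₂)] at i1 i2
    by_cases hx : x = 0
    · by_cases hy : y = 0
      · simp [hx, hy] at hv
      · right
        apply mul_left_cancel₀ hy
        linarith
    · left
      apply mul_left_cancel₀ hx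
      linarith
  · rintro (rfl | rfl)
    · refine ⟨e₁, ?_, ha⟩
      rintro rfl
      simp at h₁
    · refine ⟨e₂, ?_, hb⟩
      rintro rfl
      simp at h₂

/-- The trace of a diagonalized pencil in terms of an arbitrary pair of vectors. -/
lemma trace_pencil_mul_det (hV : Module.finrank ℝ V = 2) (P Q : V →ₗ[ℝ] E)
    {a b : ℝ} {e₁ e₂ : V}
    (h₁ : inner ℝ (P e₁) (P e₁) = (1 : ℝ)) (h₂ : inner ℝ (P e₂) (P e₂) = (1 : ℝ))
    (h₁₂ : inner ℝ (P e₁) (P e₂) = (0 : ℝ)) (ha : -Q e₁ = a • P e₁) (hb : -Q e₂ = b • P e₂)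
    (u v : V) :
    (a + b) * (inner ℝ (P u) (P u) * inner ℝ (P v) (P v) - inner ℝ (P u) (P v) ^ 2) =
      -(inner ℝ (P v) (P v) * inner ℝ (Q u) (P u) - 2 * inner ℝ (P u) (P v) * inner ℝ (Q u) (P v)
        + inner ℝ (P u) (P u) * inner ℝ (Q v) (P v)) := by
  obtain ⟨x, y, rfl⟩ := exists_eq_smul_add_smul hV P h₁ h₂ h₁₂ u
  obtain ⟨z, w, rfl⟩ := exists_eq_smul_add_smul hV P h₁ h₂ h₁₂ v
  have ha' : Q e₁ = -(a • P e₁) := by rw [← ha, neg_neg]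
  have hb' : Q e₂ = -(b • P e₂) := by rw [← hb, neg_neg]
  have h₂₁ : inner ℝ (P e₂) (P e₁) = (0 : ℝ) := by rw [real_inner_comm, h₁₂]
  simp only [map_add, map_smul, ha', hb', inner_add_left, inner_add_right, inner_smul_left,
    inner_smul_right, inner_neg_left, smul_neg, h₁, h₂, h₁₂, h₂₁, conj_trivial]
  ring

/-- The Gram determinant of two linearly independent vectors is nonzero. -/
lemma gram_det_ne_zero {x y : E} (h : LinearIndependent ℝ ![x, y]) :
    inner ℝ x x * inner ℝ y y - inner ℝ x y ^ 2 ≠ (0 : ℝ) := by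
  rw [LinearIndependent.pair_iff] at h
  intro h0
  have hx : x ≠ 0 := by
    rintro rfl
    exact one_ne_zero (h 1 0 (by simp)).1
  -- The squared norm of this vector is `‖x‖²` times the Gram determinant, so a vanishing
  -- determinant yields a linear relation.
  have hz : inner ℝ (inner ℝ x y • x - inner ℝ x x • y) (inner ℝ x y • x - inner ℝ x x • y)
      = (0 : ℝ) := by
    simp only [inner_sub_left, inner_sub_right, inner_smul_left, inner_smul_right, conj_trivial,
      real_inner_comm x y]
    linear_combination inner ℝ x x * h0
  have := (h (inner ℝ x y) (-inner ℝ x x) (by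
    rw [neg_smul, ← sub_eq_add_neg]; exact inner_self_eq_zero.mp hz)).2
  exact hx (inner_self_eq_zero.mp (neg_eq_zero.mp this))

end PencilOfForms

/-! ### First and second fundamental forms of the surface -/

section Surfaces

variable {S : Set S3} [ChartedSpace (EuclideanSpace ℝ (Fin 2)) S]

/-- The inverse of the preferred chart at `p`, as a map from the plane to the surface. -/
noncomputable abbrev surfParam (p : S) : EuclideanSpace ℝ (Fin 2) → S :=
  (extChartAt (𝓡 2) p).symm

lemma finrank_tangentSpace_surf (p : S) : Module.finrank ℝ (TangentSpace (𝓡 2) p) = 2 :=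
  finrank_euclideanSpace_fin (𝕜 := ℝ) (n := 2)

lemma contMDiff_surf_coe (hS : Manifold.IsSmoothEmbedding (𝓡 2) (𝓡 3) ∞ (Subtype.val : S → S3)) :
    ContMDiff (𝓡 2) 𝓘(ℝ, E4) ∞ (fun q : S => ((q : S3) : E4)) :=
  (contMDiff_coe_sphere (m := ∞)).comp hS.contMDiff

lemma surfIncl_eq (hS : Manifold.IsSmoothEmbedding (𝓡 2) (𝓡 3) ∞ (Subtype.val : S → S3)) (p : S) :
    surfIncl p = (sphereIncl (p : S3)).comp (mfderiv (𝓡 2) (𝓡 3) (Subtype.val : S → S3) p) :=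
  mfderiv_comp p (mdifferentiableAt_sphere_coe (p : S3))
    (hS.contMDiff.mdifferentiableAt (by simp))

lemma surfParam_apply_self (p : S) : surfParam p (extChartAt (𝓡 2) p p) = p :=
  extChartAt_to_inv p

/-- The differential of an immersion is injective. -/
lemma injective_mfderiv_surf_val
    (hS : Manifold.IsSmoothEmbedding (𝓡 2) (𝓡 3) ∞ (Subtype.val : S → S3)) (p : S) :
    Function.Injective (mfderiv (𝓡 2) (𝓡 3) (Subtype.val : S → S3) p) := by
  have h := hS.isImmersion.isImmersionAt p
  have hdom : h.domChart.MDifferentiable (𝓡 2) (𝓡 2) :=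
    ⟨fun x hx => (mdifferentiableAt_of_mem_maximalAtlas
        (IsManifold.maximalAtlas_subset_of_le (by simp) h.domChart_mem_maximalAtlas) hx).mdifferentiableWithinAt,
      fun x hx => (mdifferentiableAt_symm_of_mem_maximalAtlas
        (IsManifold.maximalAtlas_subset_of_le (by simp) h.domChart_mem_maximalAtlas) hx).mdifferentiableWithinAt⟩
  -- In the immersion charts the inclusion reads `u ↦ h.equiv (u, 0)`, and `L` is a left inverse of
  -- it. So `L ∘ h.codChart ∘ Subtype.val` agrees near `p` with a chart of `S`, whose differential
  -- is injective.
  set L : EuclideanSpace ℝ (Fin 3) →L[ℝ] EuclideanSpace ℝ (Fin 2) :=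
    (ContinuousLinearMap.fst ℝ _ _).comp h.equiv.symm.toContinuousLinearMap
  have hψ : MDifferentiableAt (𝓡 3) (𝓡 3) h.codChart (p : S3) :=
    mdifferentiableAt_of_mem_maximalAtlas
      (IsManifold.maximalAtlas_subset_of_le (n := ∞) (by simp) h.codChart_mem_maximalAtlas) h.mem_codChart_source
  have hk : MDifferentiableAt (𝓡 3) (𝓡 2) (L ∘ h.codChart) (p : S3) :=
    L.differentiableAt.mdifferentiableAt.comp _ hψ
  have heq : (L ∘ h.codChart) ∘ (Subtype.val : S → S3) =ᶠ[nhds p] h.domChart := by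
    filter_upwards [h.domChart.open_source.mem_nhds h.mem_domChart_source] with q hq
    have hw := h.writtenInCharts (show h.domChart q ∈ (h.domChart.extend (𝓡 2)).target by
      simpa using h.domChart.map_source hq)
    simp only [Function.comp_apply, OpenPartialHomeomorph.extend_coe,
      OpenPartialHomeomorph.extend_coe_symm, modelWithCornersSelf_coe,
      modelWithCornersSelf_coe_symm, id_eq, h.domChart.left_inv hq] at hw
    simp [L, hw]
  have hinj := hdom.mfderiv_injective h.mem_domChart_source
  rw [← heq.mfderiv_eq, mfderiv_comp p hk (hS.contMDiff.mdifferentiableAt (by simp))] at hinj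
  exact Function.Injective.of_comp hinj

lemma surfIncl_injective (hS : Manifold.IsSmoothEmbedding (𝓡 2) (𝓡 3) ∞ (Subtype.val : S → S3))
    (p : S) : Function.Injective (surfIncl p) := by
  rw [surfIncl_eq hS]
  exact (injective_mvfderiv_subtypeVal_sphere (p : S3)).comp (injective_mfderiv_surf_val hS p)

variable [IsManifold (𝓡 2) ∞ S]

lemma mdifferentiableAt_surfParam (p : S) {y : EuclideanSpace ℝ (Fin 2)}
    (hy : y ∈ (extChartAt (𝓡 2) p).target) :
    MDifferentiableAt 𝓘(ℝ, EuclideanSpace ℝ (Fin 2)) (𝓡 2) (surfParam p) y :=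
  (contMDiffOn_extChartAt_symm (n := ∞) p y hy |>.contMDiffAt
    ((isOpen_extChartAt_target p).mem_nhds hy)).mdifferentiableAt (by simp)

/-- The differential of a local parametrization. -/
noncomputable def surfParamDeriv (p : S) (y : EuclideanSpace ℝ (Fin 2)) :
    EuclideanSpace ℝ (Fin 2) →L[ℝ] TangentSpace (𝓡 2) (surfParam p y) :=
  mfderiv 𝓘(ℝ, EuclideanSpace ℝ (Fin 2)) (𝓡 2) (surfParam p) y

lemma surfParamDeriv_bijective (p : S) {y : EuclideanSpace ℝ (Fin 2)}
    (hy : y ∈ (extChartAt (𝓡 2) p).target) : Function.Bijective (surfParamDeriv p y) := by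
  have : IsManifold (𝓡 2) 1 S := IsManifold.of_le (n := ∞) (by simp)
  have h := isInvertible_mfderivWithin_extChartAt_symm (I := 𝓡 2) hy
  simp only [ModelWithCorners.range_eq_univ, mfderivWithin_univ] at h
  exact h.bijective

lemma hasFDerivAt_comp_surfParam {f : S → E4} (hf : ContMDiff (𝓡 2) 𝓘(ℝ, E4) ∞ f) (p : S)
    {y : EuclideanSpace ℝ (Fin 2)} (hy : y ∈ (extChartAt (𝓡 2) p).target) :
    HasFDerivAt (f ∘ surfParam p)
      ((surfDeriv f (surfParam p y)).comp (surfParamDeriv p y)) y :=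
  hasMFDerivAt_iff_hasFDerivAt.mp
    ((hf.mdifferentiableAt (by simp)).hasMFDerivAt.comp y
      (mdifferentiableAt_surfParam p hy).hasMFDerivAt)

lemma contDiffOn_comp_surfParam {f : S → E4} (hf : ContMDiff (𝓡 2) 𝓘(ℝ, E4) ∞ f) (p : S) :
    ContDiffOn ℝ ∞ (f ∘ surfParam p) (extChartAt (𝓡 2) p).target :=
  (hf.comp_contMDiffOn (contMDiffOn_extChartAt_symm p)).contDiffOn

/-- Every tangent vector at `p` is the image of a vector of the parameter plane, compatibly with
the differentials of functions. -/
lemma exists_fderiv_eq_surfDeriv (p : S) (v : TangentSpace (𝓡 2) p) :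
    ∃ v' : EuclideanSpace ℝ (Fin 2), ∀ f : S → E4, ContMDiff (𝓡 2) 𝓘(ℝ, E4) ∞ f →
      fderiv ℝ (f ∘ surfParam p) (extChartAt (𝓡 2) p p) v' = surfDeriv f p v := by
  have hy := mem_extChartAt_target (I := 𝓡 2) p
  -- The chart inverse lands at `surfParam p (extChartAt (𝓡 2) p p)`, only propositionally equal to
  -- `p`; hence the transport of `v`, undone by `aux`.
  obtain ⟨v', hv'⟩ := (surfParamDeriv_bijective p hy).2
    ((surfParam_apply_self p).symm ▸ v)
  refine ⟨v', fun f hf => ?_⟩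
  rw [(hasFDerivAt_comp_surfParam hf p hy).fderiv, ContinuousLinearMap.comp_apply, hv']
  have aux : ∀ (q q' : S) (h : q = q') (w : TangentSpace (𝓡 2) q),
      surfDeriv f q' (h ▸ w) = surfDeriv f q w := by
    rintro q _ rfl w; rfl
  exact aux _ _ _ _

/-- Product rule for a constant inner product of two vector fields along the surface. -/
lemma inner_surfDeriv_add_eq_zero {f h : S → E4} (hf : ContMDiff (𝓡 2) 𝓘(ℝ, E4) ∞ f)
    (hh : ContMDiff (𝓡 2) 𝓘(ℝ, E4) ∞ h) {k : ℝ} (hk : ∀ q, inner ℝ (f q) (h q) = k) (p : S)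
    (v : TangentSpace (𝓡 2) p) :
    inner ℝ (f p) (surfDeriv h p v) + inner ℝ (surfDeriv f p v) (h p) = 0 := by
  have hy := mem_extChartAt_target (I := 𝓡 2) p
  obtain ⟨v', hv'⟩ := exists_fderiv_eq_surfDeriv p v
  have d := (hasFDerivAt_comp_surfParam hf p hy).differentiableAt.hasFDerivAt.inner ℝ
    (hasFDerivAt_comp_surfParam hh p hy).differentiableAt.hasFDerivAt
  have e : (fun t => inner ℝ ((f ∘ surfParam p) t) ((h ∘ surfParam p) t)) = fun _ => k := by
    funext t; exact hk _
  rw [e] at d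
  have d0 := congrArg (fun L => L v') (d.unique (hasFDerivAt_const k _))
  simpa only [ContinuousLinearMap.comp_apply, ContinuousLinearMap.prod_apply,
    fderivInnerCLM_apply, hv' f hf, hv' h hh, Function.comp_apply, surfParam_apply_self,
    zero_apply] using d0

variable {N : S → E4}

lemma inner_normal_surfDeriv (hN : IsUnitNormal N) (p : S) (v : TangentSpace (𝓡 2) p) :
    inner ℝ (N p) (surfDeriv N p v) = 0 := by
  have := inner_surfDeriv_add_eq_zero hN.smooth hN.smooth (k := 1)
    (fun q => by rw [real_inner_self_eq_norm_sq, hN.norm_eq_one, one_pow]) p v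
  rw [real_inner_comm (N p)] at this
  linarith

lemma inner_coe_surfIncl (hS : Manifold.IsSmoothEmbedding (𝓡 2) (𝓡 3) ∞ (Subtype.val : S → S3))
    (p : S) (v : TangentSpace (𝓡 2) p) : inner ℝ ((p : S3) : E4) (surfIncl p v) = 0 := by
  have := inner_surfDeriv_add_eq_zero (contMDiff_surf_coe hS) (contMDiff_surf_coe hS) (k := 1)
    (fun q => by rw [real_inner_self_eq_norm_sq, norm_sphere_coe, one_pow]) p v
  rw [real_inner_comm ((p : S3) : E4) (surfDeriv _ p v)] at this
  rw [surfIncl]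
  linarith

lemma inner_coe_surfDeriv_normal
    (hS : Manifold.IsSmoothEmbedding (𝓡 2) (𝓡 3) ∞ (Subtype.val : S → S3)) (hN : IsUnitNormal N)
    (p : S) (v : TangentSpace (𝓡 2) p) : inner ℝ ((p : S3) : E4) (surfDeriv N p v) = 0 := by
  have := inner_surfDeriv_add_eq_zero hN.smooth (contMDiff_surf_coe hS) hN.tangent_sphere p v
  have h0 := hN.normal p v
  rw [surfIncl] at h0
  rw [h0, zero_add] at this
  rw [real_inner_comm, this]

/-- The tangent plane at `p` is the orthogonal complement of `p` and `N p`. -/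
lemma mem_range_surfIncl_iff
    (hS : Manifold.IsSmoothEmbedding (𝓡 2) (𝓡 3) ∞ (Subtype.val : S → S3)) (hN : IsUnitNormal N)
    (p : S) (x : E4) :
    x ∈ LinearMap.range (surfIncl p).toLinearMap ↔
      inner ℝ ((p : S3) : E4) x = 0 ∧ inner ℝ (N p) x = 0 := by
  set W := Submodule.span ℝ (Set.range ![((p : S3) : E4), N p])
  have hW : ∀ z, z ∈ Wᗮ ↔ inner ℝ ((p : S3) : E4) z = 0 ∧ inner ℝ (N p) z = 0 := by
    intro z
    rw [Submodule.mem_orthogonal]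
    constructor
    · exact fun h => ⟨h _ (Submodule.subset_span ⟨0, rfl⟩), h _ (Submodule.subset_span ⟨1, rfl⟩)⟩
    · rintro ⟨h1, h2⟩ u hu
      have hu' : u ∈ Submodule.span ℝ (Set.range ![((p : S3) : E4), N p]) := hu
      rw [Matrix.range_cons, Matrix.range_cons, Matrix.range_empty, Set.union_empty,
        Set.singleton_union, Submodule.mem_span_pair] at hu'
      obtain ⟨a, b, rfl⟩ := hu'
      rw [inner_add_left, inner_smul_left, inner_smul_left, h1, h2]
      simp
  have hfW : Module.finrank ℝ W = 2 := by
    have hon : Orthonormal ℝ ![((p : S3) : E4), N p] := by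
      rw [orthonormal_iff_ite]
      have h0 := hN.tangent_sphere p
      have h0' := h0
      rw [real_inner_comm] at h0'
      intro i j
      fin_cases i <;> fin_cases j <;>
        simp [h0, h0', hN.norm_eq_one]
    simpa using finrank_span_eq_card hon.linearIndependent
  have hfo : Module.finrank ℝ Wᗮ = 2 := by
    have := W.finrank_add_finrank_orthogonal
    rw [hfW, finrank_euclideanSpace_fin] at this
    omega
  have hfr : Module.finrank ℝ (LinearMap.range (surfIncl p).toLinearMap) = 2 := by
    rw [LinearMap.finrank_range_of_inj (surfIncl_injective hS p)]
    exact finrank_tangentSpace_surf p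
  have hle : LinearMap.range (surfIncl p).toLinearMap ≤ Wᗮ := by
    rintro _ ⟨v, rfl⟩
    exact (hW _).mpr ⟨inner_coe_surfIncl hS p v, hN.normal p v⟩
  rw [Submodule.eq_of_le_of_finrank_eq hle (hfr.trans hfo.symm), hW]

/-- Differentiating `⟪N, N⟫ = 1` and `⟪N, x⟫ = 0` removes the components of `dN` along `N` and along
the position vector. This makes the shape operator an endomorphism of the tangent plane. -/
lemma surfDeriv_normal_mem_range
    (hS : Manifold.IsSmoothEmbedding (𝓡 2) (𝓡 3) ∞ (Subtype.val : S → S3)) (hN : IsUnitNormal N)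
    (p : S) (v : TangentSpace (𝓡 2) p) :
    surfDeriv N p v ∈ LinearMap.range (surfIncl p).toLinearMap :=
  (mem_range_surfIncl_iff hS hN p _).mpr
    ⟨inner_coe_surfDeriv_normal hS hN p v, inner_normal_surfDeriv hN p v⟩

/-- The second fundamental form is symmetric. -/
lemma inner_surfDeriv_surfIncl_symm
    (hS : Manifold.IsSmoothEmbedding (𝓡 2) (𝓡 3) ∞ (Subtype.val : S → S3)) (hN : IsUnitNormal N)
    (p : S) (v w : TangentSpace (𝓡 2) p) :
    inner ℝ (surfDeriv N p v) (surfIncl p w) = inner ℝ (surfIncl p v) (surfDeriv N p w) := by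
  have hy := mem_extChartAt_target (I := 𝓡 2) p
  have hnhds := (isOpen_extChartAt_target (I := 𝓡 2) p).mem_nhds hy
  obtain ⟨v', hv'⟩ := exists_fderiv_eq_surfDeriv p v
  obtain ⟨w', hw'⟩ := exists_fderiv_eq_surfDeriv p w
  have hF := contMDiff_surf_coe hS
  set F : S → E4 := fun q => ((q : S3) : E4)
  set y := extChartAt (𝓡 2) p p
  set φ := F ∘ surfParam p
  set n := N ∘ surfParam p
  have hφ : ContDiffAt ℝ ∞ φ y := (contDiffOn_comp_surfParam hF p).contDiffAt hnhds
  have hn : HasFDerivAt n (fderiv ℝ n y) y :=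
    (hasFDerivAt_comp_surfParam hN.smooth p hy).differentiableAt.hasFDerivAt
  have hD : HasFDerivAt (fderiv ℝ φ) (fderiv ℝ (fderiv ℝ φ) y) y :=
    ((hφ.fderiv_right (m := 1) (by exact WithTop.coe_le_coe.mpr le_top)).differentiableAt one_ne_zero).hasFDerivAt
  -- Differentiating `⟪n, ∂_b φ⟫ = 0` in the direction `a` expresses the second fundamental form
  -- through the Hessian of `φ`, whose symmetry then gives the claim.
  have key : ∀ a b, inner ℝ (n y) (fderiv ℝ (fderiv ℝ φ) y a b) +
      inner ℝ (fderiv ℝ n y a) (fderiv ℝ φ y b) = 0 := by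
    intro a b
    have d := hn.inner ℝ (hD.clm_apply (hasFDerivAt_const b y))
    have e : (fun t => inner ℝ (n t) (fderiv ℝ φ t b)) =ᶠ[nhds y] fun _ => (0 : ℝ) := by
      filter_upwards [hnhds] with t ht
      rw [(hasFDerivAt_comp_surfParam hF p ht).fderiv]
      exact hN.normal _ _
    have d0 := congrArg (fun L => L a) (d.unique
      ((hasFDerivAt_const (0 : ℝ) y).congr_of_eventuallyEq e))
    simpa [fderivInnerCLM_apply] using d0
  have hsym : fderiv ℝ (fderiv ℝ φ) y v' w' = fderiv ℝ (fderiv ℝ φ) y w' v' :=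
    (hφ.isSymmSndFDerivAt (by
      rw [minSmoothness_of_isRCLikeNormedField]; exact WithTop.coe_le_coe.mpr le_top)) v' w'
  have k1 := key v' w'
  have k2 := key w' v'
  rw [hv' N hN.smooth, hw' F hF] at k1
  rw [hw' N hN.smooth, hv' F hF, ← hsym] at k2
  change inner ℝ (surfDeriv N p v) (surfDeriv F p w) = inner ℝ (surfDeriv F p v) (surfDeriv N p w)
  rw [real_inner_comm (surfDeriv N p w)]
  linarith

end Surfaces

/-! ### Principal curvatures and continuity of their sum -/

section PrincipalCurvatures

variable {S : Set S3} [ChartedSpace (EuclideanSpace ℝ (Fin 2)) S] {N : S → E4}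

/-- The entries of any diagonalization of the shape operator are the principal curvatures. -/
lemma IsPrincipalBasis.principalCurvature_eq {p : S} {a b : ℝ} {e₁ e₂ : TangentSpace (𝓡 2) p}
    (h : IsPrincipalBasis N p a b e₁ e₂) :
    principalCurvature₁ N p = min a b ∧ principalCurvature₂ N p = max a b := by
  have hset : {μ : ℝ | IsPrincipalCurvatureAt N p μ} = {a, b} :=
    setOf_eigenvalues_eq_pair (finrank_tangentSpace_surf p) (surfIncl p).toLinearMap
      (surfDeriv N p).toLinearMap h.1 h.2.1 h.2.2.1 h.2.2.2.1 h.2.2.2.2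
  rw [principalCurvature₁, principalCurvature₂, hset]
  exact ⟨csInf_pair a b, csSup_pair a b⟩

variable [IsManifold (𝓡 2) ∞ S]

/-- The shape operator is diagonal in an orthonormal basis, with the principal curvatures as
entries. -/
lemma exists_isPrincipalBasis
    (hS : Manifold.IsSmoothEmbedding (𝓡 2) (𝓡 3) ∞ (Subtype.val : S → S3)) (hN : IsUnitNormal N)
    (p : S) : principalCurvature₁ N p ≤ principalCurvature₂ N p ∧
      ∃ e₁ e₂ : TangentSpace (𝓡 2) p,
        IsPrincipalBasis N p (principalCurvature₁ N p) (principalCurvature₂ N p) e₁ e₂ := by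
  obtain ⟨a, b, e₁, e₂, hab, h⟩ := exists_orthonormal_eigenvectors (finrank_tangentSpace_surf p)
    (surfIncl p).toLinearMap (surfDeriv N p).toLinearMap (surfIncl_injective hS p)
    (inner_surfDeriv_surfIncl_symm hS hN p) (surfDeriv_normal_mem_range hS hN p)
  have hb : IsPrincipalBasis N p a b e₁ e₂ := h
  obtain ⟨h1, h2⟩ := hb.principalCurvature_eq
  rw [min_eq_left hab] at h1
  rw [max_eq_right hab] at h2
  rw [h1, h2]
  exact ⟨hab, e₁, e₂, hb⟩

/-- The sum of the principal curvatures is continuous. -/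
lemma continuous_principalCurvature_add
    (hS : Manifold.IsSmoothEmbedding (𝓡 2) (𝓡 3) ∞ (Subtype.val : S → S3)) (hN : IsUnitNormal N) :
    Continuous (fun q : S => principalCurvature₁ N q + principalCurvature₂ N q) := by
  rw [continuous_iff_continuousAt]
  intro p
  have hy := mem_extChartAt_target (I := 𝓡 2) p
  have hopen := isOpen_extChartAt_target (I := 𝓡 2) p
  have hF := contMDiff_surf_coe hS
  set F : S → E4 := fun q => ((q : S3) : E4)
  set y₀ := extChartAt (𝓡 2) p p
  set u : EuclideanSpace ℝ (Fin 2) := EuclideanSpace.single 0 1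
  set v : EuclideanSpace ℝ (Fin 2) := EuclideanSpace.single 1 1
  have huv : LinearIndependent ℝ ![u, v] := by
    rw [LinearIndependent.pair_iff]
    intro s t h
    have h0 := congrArg (fun z => z.ofLp 0) h
    have h1 := congrArg (fun z => z.ofLp 1) h
    simpa [u, v] using And.intro h0 h1
  have hcont : ∀ {f : S → E4}, ContMDiff (𝓡 2) 𝓘(ℝ, E4) ∞ f → ∀ w,
      ContinuousAt (fun y => fderiv ℝ (f ∘ surfParam p) y w) y₀ := fun hf w =>
    (((contDiffOn_comp_surfParam hf p).continuousOn_fderiv_of_isOpen hopen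
      (by simp)).continuousAt (hopen.mem_nhds hy)).clm_apply continuousAt_const
  set φ := fun w y => fderiv ℝ (F ∘ surfParam p) y w
  set n := fun w y => fderiv ℝ (N ∘ surfParam p) y w
  -- Principal directions need not vary continuously, so the trace is computed in the coordinate
  -- frame as `M / D`, with `D` the Gram determinant of the first fundamental form.
  set D : EuclideanSpace ℝ (Fin 2) → ℝ := fun y =>
    inner ℝ (φ u y) (φ u y) * inner ℝ (φ v y) (φ v y) - inner ℝ (φ u y) (φ v y) ^ 2 with hD
  set M : EuclideanSpace ℝ (Fin 2) → ℝ := fun y =>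
    -(inner ℝ (φ v y) (φ v y) * inner ℝ (n u y) (φ u y)
      - 2 * inner ℝ (φ u y) (φ v y) * inner ℝ (n u y) (φ v y)
      + inner ℝ (φ u y) (φ u y) * inner ℝ (n v y) (φ v y)) with hM
  have hφ : ∀ w, ContinuousAt (φ w) y₀ := hcont hF
  have hn : ∀ w, ContinuousAt (n w) y₀ := hcont hN.smooth
  have hDc : ContinuousAt D y₀ :=
    (((hφ u).inner (𝕜 := ℝ) (hφ u)).mul ((hφ v).inner (𝕜 := ℝ) (hφ v))).sub
      (((hφ u).inner (𝕜 := ℝ) (hφ v)).pow 2)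
  have hMc : ContinuousAt M y₀ :=
    (((((hφ v).inner (𝕜 := ℝ) (hφ v)).mul ((hn u).inner (𝕜 := ℝ) (hφ u))).sub
      ((continuousAt_const.mul ((hφ u).inner (𝕜 := ℝ) (hφ v))).mul
        ((hn u).inner (𝕜 := ℝ) (hφ v)))).add
      (((hφ u).inner (𝕜 := ℝ) (hφ u)).mul ((hn v).inner (𝕜 := ℝ) (hφ v)))).neg
  have hφ_eq : ∀ y ∈ (extChartAt (𝓡 2) p).target, ∀ w,
      φ w y = surfIncl (surfParam p y) (surfParamDeriv p y w) := fun y hy w =>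
    congrArg (fun L => L w) (hasFDerivAt_comp_surfParam hF p hy).fderiv
  have hn_eq : ∀ y ∈ (extChartAt (𝓡 2) p).target, ∀ w,
      n w y = surfDeriv N (surfParam p y) (surfParamDeriv p y w) := fun y hy w =>
    congrArg (fun L => L w) (hasFDerivAt_comp_surfParam hN.smooth p hy).fderiv
  have hD0 : ∀ y ∈ (extChartAt (𝓡 2) p).target, D y ≠ 0 := by
    intro y hy
    apply gram_det_ne_zero
    have hinj : Function.Injective (fderiv ℝ (F ∘ surfParam p) y) := by
      rw [(hasFDerivAt_comp_surfParam hF p hy).fderiv]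
      exact (surfIncl_injective hS _).comp (surfParamDeriv_bijective p hy).1
    have := huv.map' (fderiv ℝ (F ∘ surfParam p) y).toLinearMap (LinearMap.ker_eq_bot.mpr hinj)
    convert! this using 1
    ext i
    fin_cases i <;> rfl
  have hT : ∀ y ∈ (extChartAt (𝓡 2) p).target,
      principalCurvature₁ N (surfParam p y) + principalCurvature₂ N (surfParam p y) =
        M y / D y := by
    intro y hy
    obtain ⟨-, e₁, e₂, h⟩ := exists_isPrincipalBasis hS hN (surfParam p y)
    rw [eq_div_iff (hD0 y hy)]
    simp only [hD, hM, hφ_eq y hy, hn_eq y hy]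
    exact trace_pencil_mul_det (finrank_tangentSpace_surf _) (surfIncl (surfParam p y)).toLinearMap
      (surfDeriv N (surfParam p y)).toLinearMap h.1 h.2.1 h.2.2.1 h.2.2.2.1 h.2.2.2.2 _ _
  have hq : ContinuousAt (fun q => M (extChartAt (𝓡 2) p q) / D (extChartAt (𝓡 2) p q)) p :=
    ContinuousAt.comp (f := extChartAt (𝓡 2) p) (g := fun y => M y / D y)
      (hMc.div hDc (hD0 y₀ hy)) (continuousAt_extChartAt p)
  refine hq.congr ?_
  filter_upwards [extChartAt_source_mem_nhds (I := 𝓡 2) p] with q hq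
  have := hT _ ((extChartAt (𝓡 2) p).map_source hq)
  rw [surfParam, (extChartAt (𝓡 2) p).left_inv hq] at this
  exact this.symm

end PrincipalCurvatures

/-! ### Effect of an ambient isometry on the principal curvatures -/

section Homogeneity

variable {S : Set S3} [ChartedSpace (EuclideanSpace ℝ (Fin 2)) S] {N : S → E4}

lemma surfDeriv_clm_comp (L : E4 →L[ℝ] E4) {f : S → E4} (hf : ContMDiff (𝓡 2) 𝓘(ℝ, E4) ∞ f)
    (p : S) (v : TangentSpace (𝓡 2) p) :
    surfDeriv (fun x => L (f x)) p v = L (surfDeriv f p v) := by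
  have hL : HasMFDerivAt 𝓘(ℝ, E4) 𝓘(ℝ, E4) L (f p) L := L.hasFDerivAt.hasMFDerivAt
  have h := (hL.comp p (hf.mdifferentiableAt (by simp)).hasMFDerivAt).mfderiv
  exact congrArg (fun L => L v) h

variable [IsManifold (𝓡 2) ∞ S]

/-- A Riemannian isometry of `𝕊³` preserving `S` maps principal bases to principal bases, up to
a global change of orientation. -/
lemma principalCurvature_isometry
    (hS : Manifold.IsSmoothEmbedding (𝓡 2) (𝓡 3) ∞ (Subtype.val : S → S3))
    (hconn : IsConnected S) (hN : IsUnitNormal N) {g : Diffeomorph (𝓡 3) (𝓡 3) S3 S3 ∞}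
    (hg : g ∈ IsomS3) (hgS : g '' S ⊆ S) {p q : S} (hpq : g p = q) :
    (principalCurvature₁ N q = principalCurvature₁ N p ∧
      principalCurvature₂ N q = principalCurvature₂ N p) ∨
    (principalCurvature₁ N q = -principalCurvature₂ N p ∧
      principalCurvature₂ N q = -principalCurvature₁ N p) := by
  obtain ⟨A, hA⟩ := exists_linearIsometryEquiv_of_mem_isomS3 hg
  have hF := contMDiff_surf_coe hS
  set G : S → S := fun x => ⟨g x, hgS ⟨x, x.2, rfl⟩⟩
  have hG : ContMDiff (𝓡 2) (𝓡 2) ∞ G := by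
    refine (ContMDiff.iff_comp_isImmersion hS.isImmersion).mpr ⟨?_, ?_⟩
    · exact (g.continuous.comp continuous_subtype_val).subtype_mk _
    · exact g.contMDiff.comp hS.contMDiff
  have hGd : ∀ x, MDifferentiableAt (𝓡 2) (𝓡 2) G x := fun x => hG.mdifferentiableAt (by simp)
  have hchain : ∀ {f : S → E4}, ContMDiff (𝓡 2) 𝓘(ℝ, E4) ∞ f → ∀ x (v : TangentSpace (𝓡 2) x),
      surfDeriv (f ∘ G) x v = surfDeriv f (G x) (mfderiv (𝓡 2) (𝓡 2) G x v) := fun hf x v =>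
    mfderiv_comp_apply x (hf.mdifferentiableAt (by simp)) (hGd x) v
  have hincl : ∀ x (v : TangentSpace (𝓡 2) x),
      surfIncl (G x) (mfderiv (𝓡 2) (𝓡 2) G x v) = A (surfIncl x v) := by
    intro x v
    have e : (fun q : S => ((q : S3) : E4)) ∘ G =
        fun z : S => A ((z : S3) : E4) := by
      funext z; exact hA z
    rw [surfIncl, ← hchain hF, e]
    exact surfDeriv_clm_comp A.toContinuousLinearEquiv.toContinuousLinearMap hF x v
  have hsurj : ∀ x, Function.Surjective (mfderiv (𝓡 2) (𝓡 2) G x) := by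
    intro x
    have hinj : Function.Injective (mfderiv (𝓡 2) (𝓡 2) G x).toLinearMap := by
      intro v w h
      apply surfIncl_injective hS x
      apply A.injective
      rw [← hincl, ← hincl]
      exact congrArg _ h
    have f1 : FiniteDimensional ℝ (TangentSpace (𝓡 2) x) :=
      Module.finite_of_finrank_eq_succ (finrank_tangentSpace_surf x)
    have f2 : FiniteDimensional ℝ (TangentSpace (𝓡 2) (G x)) :=
      Module.finite_of_finrank_eq_succ (finrank_tangentSpace_surf (G x))
    exact (LinearMap.injective_iff_surjective_of_finrank_eq_finrank
      ((finrank_tangentSpace_surf x).trans (finrank_tangentSpace_surf (G x)).symm)).mp hinj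
  set s : S → ℝ := fun x => inner ℝ (A (N x)) (N (G x))
  have hAN : ∀ x, A (N x) = s x • N (G x) := by
    intro x
    -- The difference is orthogonal to `G x` and to `N (G x)`, hence tangent to `S`. But `A (N x)`
    -- and `N (G x)` are both normal to `S`, since the tangent plane at `G x` is the image under `A`
    -- of the one at `x`. So the difference is orthogonal to itself.
    have hx : A (N x) - s x • N (G x) ∈ LinearMap.range (surfIncl (G x)).toLinearMap := by
      rw [mem_range_surfIncl_iff hS hN]
      constructor
      · have e : ((G x : S3) : E4) = A ((x : S3) : E4) := hA x
        rw [inner_sub_right, inner_smul_right, real_inner_comm (N (G x)), hN.tangent_sphere, e,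
          A.inner_map_map, real_inner_comm, hN.tangent_sphere]
        simp
      · rw [inner_sub_right, inner_smul_right, real_inner_self_eq_norm_sq, hN.norm_eq_one,
          real_inner_comm]
        simp [s]
    obtain ⟨w, hw⟩ := hx
    obtain ⟨v, rfl⟩ := hsurj x w
    have h0 : inner ℝ (A (N x) - s x • N (G x)) (A (N x) - s x • N (G x)) = (0 : ℝ) := by
      nth_rewrite 2 [← hw]
      rw [inner_sub_left, inner_smul_left]
      have e1 := hN.normal (G x) (mfderiv (𝓡 2) (𝓡 2) G x v)
      have e2 := hN.normal x v
      rw [← A.inner_map_map, ← hincl] at e2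
      change inner ℝ (A (N x)) (surfIncl (G x) _) - _ * inner ℝ (N (G x)) (surfIncl (G x) _) = 0
      rw [e1, e2]
      simp
    exact sub_eq_zero.mp (inner_self_eq_zero.mp h0)
  have hs : ∀ x, s x ^ 2 = 1 := by
    intro x
    have := congrArg (fun z => ‖z‖ ^ 2) (hAN x)
    simpa [norm_smul, hN.norm_eq_one, A.norm_map] using this.symm
  have hsc : Continuous s :=
    (A.continuous.comp hN.smooth.continuous).inner (hN.smooth.continuous.comp hG.continuous)
  have : PreconnectedSpace S := isPreconnected_iff_preconnectedSpace.mp hconn.isPreconnected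
  -- A constant sign is what allows `N ∘ G = ε • A ∘ N` to be differentiated.
  obtain ⟨ε, hε, hsε⟩ : ∃ ε : ℝ, (ε = 1 ∨ ε = -1) ∧ ∀ x, s x = ε := by
    rcases isPreconnected_univ.eq_or_eq_neg_of_sq_eq hsc.continuousOn
      (continuousOn_const (c := (1 : ℝ))) (fun x _ => by simp [hs x])
      (fun _ => one_ne_zero) with h | h
    · exact ⟨1, Or.inl rfl, fun x => h (Set.mem_univ x)⟩
    · exact ⟨-1, Or.inr rfl, fun x => h (Set.mem_univ x)⟩
  have hNG : ∀ x (v : TangentSpace (𝓡 2) x),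
      surfDeriv N (G x) (mfderiv (𝓡 2) (𝓡 2) G x v) = ε • A (surfDeriv N x v) := by
    intro x v
    have hε2 : ε * ε = 1 := by rcases hε with rfl | rfl <;> norm_num
    have e : N ∘ G = fun z => (ε • A.toContinuousLinearEquiv.toContinuousLinearMap) (N z) := by
      funext z
      change N (G z) = ε • A (N z)
      rw [hAN, hsε, smul_smul, hε2, one_smul]
    rw [← hchain hN.smooth, e]
    exact surfDeriv_clm_comp _ hN.smooth x v
  have hGp : G p = q := Subtype.ext hpq
  obtain ⟨hle, e₁, e₂, h1, h2, h12, ha, hb⟩ := exists_isPrincipalBasis hS hN p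
  have hb' : IsPrincipalBasis N (G p) (ε * principalCurvature₁ N p) (ε * principalCurvature₂ N p)
      (mfderiv (𝓡 2) (𝓡 2) G p e₁) (mfderiv (𝓡 2) (𝓡 2) G p e₂) := by
    refine ⟨?_, ?_, ?_, ?_, ?_⟩
    · rw [hincl, A.inner_map_map, h1]
    · rw [hincl, A.inner_map_map, h2]
    · rw [hincl, hincl, A.inner_map_map, h12]
    · rw [hincl, hNG, ← smul_neg, ← map_neg, ha, map_smul, smul_smul]
    · rw [hincl, hNG, ← smul_neg, ← map_neg, hb, map_smul, smul_smul]
  -- For `ε = -1` the order of the two eigenvalues is reversed, which the `min` and `max` record.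
  have hfin := hb'.principalCurvature_eq
  rw [hGp] at hfin
  rcases hε with rfl | rfl
  · left
    simpa [hle] using hfin
  · right
    simpa [hle] using hfin

end Homogeneity

/-! ### Constancy of the curvatures -/

theorem mainTheorem3
    (S : Set S3) [ChartedSpace (EuclideanSpace ℝ (Fin 2)) S] [IsManifold (𝓡 2) ∞ S]
    (hS : Manifold.IsSmoothEmbedding (𝓡 2) (𝓡 3) ∞ (Subtype.val : S → S3))
    (hconn : IsConnected S)
    (N : S → E4) (hN : IsUnitNormal N)
    (hhom : ExtrinsicallyHomogeneous S) :
    (∀ p : S, ∃ e₁ e₂ : TangentSpace (𝓡 2) p,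
      IsPrincipalBasis N p (principalCurvature₁ N p) (principalCurvature₂ N p) e₁ e₂) ∧
    (∃ k : ℝ, ∀ p : S, gaussianCurvature N p = k) ∧
    (∃ a : ℝ, ∀ p : S, principalCurvature₁ N p = a) ∧
    (∃ b : ℝ, ∀ p : S, principalCurvature₂ N p = b) := by
  obtain ⟨x₀, hx₀⟩ := hconn.nonempty
  set p₀ : S := ⟨x₀, hx₀⟩
  set a := principalCurvature₁ N p₀
  set b := principalCurvature₂ N p₀
  have hall : ∀ q : S, (principalCurvature₁ N q = a ∧ principalCurvature₂ N q = b) ∨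
      (principalCurvature₁ N q = -b ∧ principalCurvature₂ N q = -a) := by
    intro q
    obtain ⟨g, hg, hgS, hgx⟩ := hhom p₀ p₀.2 q q.2
    exact principalCurvature_isometry hS hconn hN hg hgS hgx
  have hconst : ∀ q : S, principalCurvature₁ N q = a ∧ principalCurvature₂ N q = b := by
    by_cases hab : a + b = 0
    · intro q
      rcases hall q with h | ⟨h1, h2⟩
      · exact h
      · exact ⟨by linarith, by linarith⟩
    · have : PreconnectedSpace S := isPreconnected_iff_preconnectedSpace.mp hconn.isPreconnected
      have hT := continuous_principalCurvature_add hS hN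
      -- The sum is continuous, its square is `(a + b) ^ 2 ≠ 0`, and it equals `a + b` at `p₀`, so
      -- it cannot switch to `-(a + b)`.
      have heq := isPreconnected_univ.eq_of_sq_eq hT.continuousOn
        (continuousOn_const (c := a + b)) (fun q _ => by
          rcases hall q with ⟨h1, h2⟩ | ⟨h1, h2⟩ <;> simp [h1, h2]; ring)
        (fun _ => hab) (Set.mem_univ p₀) rfl
      intro q
      rcases hall q with h | ⟨h1, h2⟩
      · exact h
      · have := heq (Set.mem_univ q)
        simp only [h1, h2] at this
        exact absurd (by linarith) hab
  refine ⟨fun p => (exists_isPrincipalBasis hS hN p).2, ⟨1 + a * b, fun p => ?_⟩,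
    ⟨a, fun p => (hconst p).1⟩, ⟨b, fun p => (hconst p).2⟩⟩
  rw [gaussianCurvature, (hconst p).1, (hconst p).2]
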